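/- **Definitions.** A *gm-space* is a triple $\mathbb X=(X,g,\xi)$ of a Polish space $X$, a Borel probability measure $\xi$ on $X$ and a *gauge* $g\in L^2_{\mathrm{sym}}(X\times X,\xi\otimes\xi)$ (real-valued, square integrable, symmetric). For gm-spaces $\mathbb X=(X,g,\xi)$, $\mathbb Y=(Y,h,\upsilon)$ let $\Pi(\mathbb X,\mathbb Y)$ be the set of Borel probability measures on $X\times Y$ with marginals $\xi,\upsilon$, let $$\mathrm{GW}(\mathbb X,\mathbb Y)=\inf_{\pi\in\Pi(\mathbb X,\mathbb Y)}\Bigl(\iint |g(x,x')-h(y,y')|^2\,d\pi(x,y)\,d\pi(x',y')\Bigr)^{1/2},$$ and let $\Pi_{\mathrm o}(\mathbb X,\mathbb Y)$ be the set of minimizers. Write $\mathbb X\simeq\mathbb Y$ if $\mathrm{GW}(\mathbb X,\mathbb Y)=0$, and $\llbracket\mathbb X\rrbracket$ for the class of $\mathbb X$. The *tangent space* $\mathfrak T_{\mathfrak Y}$ at a class $\mathfrak Y$ consists of the gauges $f|_{\mathbb Y}$, $f\in L^2_{\mathrm{sym}}(Y\times Y,\upsilon\otimes\upsilon)$, on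 all representatives $\mathbb Y=(Y,h,\upsilon)\in\mathfrak Y$, modulo the relation $f|_{\mathbb Y}\simeq\tilde f|_{\tilde{\mathbb Y}}$ iff there is $\tau\in\Pi_{\mathrm o}(\mathbb Y,\tilde{\mathbb Y})$ with $f(y,y')=\tilde f(\tilde y,\tilde y')$ for $\tau\otimes\tau$-a.e. $((y,\tilde y),(y',\tilde y'))$. Its metric is $$d_{\mathfrak T_{\mathfrak Y}}(\llbracket f|_{\mathbb Y}\rrbracket,\llbracket\tilde f|_{\tilde{\mathbb Y}}\rrbracket)=\inf_{\tau\in\Pi_{\mathrm o}(\mathbb Y,\tilde{\mathbb Y})}\Bigl(\iint|f(y,y')-\tilde f(\tilde y,\tilde y')|^2\,d\tau(y,\tilde y)\,d\tau(y',\tilde y')\Bigr)^{1/2}.$$ Two plans $\pi,\pi^*\in\Pi_{\mathrm o}(\mathbb Y,\mathbb X)$ are *equivalent with respect to $\mathbb Y$*, $\pi^*\simeq_{\mathbb Y}\pi$, if there are $\sigma\in\Pi_{\mathrm o}(\mathbb Y,\mathbb Y)$ and a Borel probability measure $\gamma$ on $Y\times Y\times X$ whose marginal on the first and second factor is $\sigma$,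 on the first and third factor is $\pi$, and on the second and third factor is $\pi^*$. **Theorem.** Let $\mathbb Y=(Y,h,\upsilon)$ and $\mathbb X_i=(X_i,g_i,\xi_i)$, $i=1,\dots,N$, be gm-spaces, let $\rho_1,\dots,\rho_N\ge 0$ with $\sum_i\rho_i=1$, and let $\pi_i\in\Pi_{\mathrm o}(\mathbb Y,\mathbb X_i)$. Put $\mathfrak Y=\llbracket\mathbb Y\rrbracket$, $X_\times=X_1\times\dots\times X_N$, $m_\rho(x,x')=\sum_{i=1}^N\rho_i g_i(x_i,x_i')$ for $x,x'\in X_\times$, and $$\mathfrak g_i=\llbracket(g_i-h)|_{(Y\times X_i,\,h,\,\pi_i)}\rrbracket\in\mathfrak T_{\mathfrak Y}$$ (gauges on a factor are regarded as functions on products via the projection). Then the tangential barycenter problem $$\inf_{\mathfrak f\in\mathfrak T_{\mathfrak Y}}\ \sum_{i=1}^N\rho_i\,d_{\mathfrak T_{\mathfrak Y}}^2(\mathfrak g_i,\mathfrak f)$$ admits a solution. Moreover, there exist plans $\pi_i^*\simeq_{\mathbb Y}\pi_i$, $i=1,\dots,N$, and a Borel probability measure $\gamma^*$ on $Y\times X_\times$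 with marginal $\pi_i^*$ on $Y\times X_i$ for every $i$ (a gluing of $\pi_1^*,\dots,\pi_N^*$ along $\mathbb Y$) such that $$\mathfrak m_\rho=\llbracket(m_\rho-h)|_{(Y\times X_\times,\,h,\,\gamma^*)}\rrbracket$$ is a solution of this problem. -/

import Mathlib

universe u

open MeasureTheory ProbabilityTheory
open scoped ENNReal

namespace GromovWasserstein

noncomputable section

section Gauges

variable {X Y : Type*} [MeasurableSpace X] [MeasurableSpace Y]

/-- The pull back `Ψ^# g` of a kernel `g` on `X × X` through `Ψ : Y → X`. -/
def pull {X Y : Type*} (Ψ : Y → X) (g : X × X → ℝ) : Y × Y → ℝ :=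
  fun p => g (Ψ p.1, Ψ p.2)

/-- `g` is (a representative of) an element of `L²_sym(X × X, ξ ⊗ ξ)`. -/
structure IsGauge (g : X × X → ℝ) (ξ : Measure X) : Prop where
  memLp : MemLp g 2 (ξ.prod ξ)
  symm : ∀ᵐ p ∂(ξ.prod ξ), g p.swap = g p

theorem measurePreserving_pair {ζ : Measure Y} {ξ : Measure X} [SFinite ζ] [SFinite ξ]
    {Φ : Y → X} (hΦ : MeasurePreserving Φ ζ ξ) :
    MeasurePreserving (fun p : Y × Y => (Φ p.1, Φ p.2)) (ζ.prod ζ) (ξ.prod ξ) :=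
  hΦ.prod hΦ

theorem IsGauge.pull {ζ : Measure Y} {ξ : Measure X} [SFinite ζ] [SFinite ξ]
    {Φ : Y → X} (hΦ : MeasurePreserving Φ ζ ξ) {g : X × X → ℝ} (hg : IsGauge g ξ) :
    IsGauge (pull Φ g) ζ where
  memLp := hg.memLp.comp_measurePreserving (measurePreserving_pair hΦ)
  symm := (measurePreserving_pair hΦ).quasiMeasurePreserving.ae hg.symm

theorem IsGauge.sub {ξ : Measure X} {g h : X × X → ℝ} (hg : IsGauge g ξ) (hh : IsGauge h ξ) :
    IsGauge (g - h) ξ where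
  memLp := hg.memLp.sub hh.memLp
  symm := by
    filter_upwards [hg.symm, hh.symm] with p h1 h2
    simp [h1, h2]

theorem IsGauge.weightedSum {ξ : Measure X} {N : ℕ} (ρ : Fin N → ℝ) {g : Fin N → X × X → ℝ}
    (hg : ∀ i, IsGauge (g i) ξ) : IsGauge (fun p => ∑ i, ρ i * g i p) ξ where
  memLp := memLp_finsetSum _ fun i _ => (hg i).memLp.const_mul (ρ i)
  symm := by
    filter_upwards [ae_all_iff.2 fun i => (hg i).symm] with p hp
    simp [hp]

/-- `‖f(·₁,·₃) - f'(·₂,·₄)‖_{L²(τ(·₁,·₂) ⊗ τ(·₃,·₄))}`, with values in `[0, ∞]`. -/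
def discrepancy (f : X × X → ℝ) (f' : Y × Y → ℝ) (τ : Measure (X × Y)) : ℝ≥0∞ :=
  eLpNorm (fun p : (X × Y) × (X × Y) => f (p.1.1, p.2.1) - f' (p.1.2, p.2.2)) 2 (τ.prod τ)

end Gauges

/-- A gauged measure space `(X, g, ξ)`. -/
structure GMSpace where
  carrier : Type u
  [top : TopologicalSpace carrier]
  [polish : PolishSpace carrier]
  [meas : MeasurableSpace carrier]
  [borel : BorelSpace carrier]
  gauge : carrier × carrier → ℝ
  measure : Measure carrier
  [prob : IsProbabilityMeasure measure]
  isGauge : IsGauge gauge measure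

instance : CoeSort GMSpace.{u} (Type u) := ⟨GMSpace.carrier⟩

attribute [instance] GMSpace.top GMSpace.polish GMSpace.meas GMSpace.borel GMSpace.prob

/-- `π ∈ Π(𝕏, 𝕐)`: a Borel probability measure on `X × Y` with marginals `ξ` and `υ`. -/
structure IsPlan (X Y : GMSpace.{u}) (π : Measure (X × Y)) : Prop where
  prob : IsProbabilityMeasure π
  fst : π.map Prod.fst = X.measure
  snd : π.map Prod.snd = Y.measure

/-- The Gromov–Wasserstein functional of a plan. -/
def gwFunctional (X Y : GMSpace.{u}) (π : Measure (X × Y)) : ℝ≥0∞ :=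
  discrepancy X.gauge Y.gauge π

/-- The Gromov–Wasserstein distance `GW₂(𝕏, 𝕐)`. -/
def gwDist (X Y : GMSpace.{u}) : ℝ≥0∞ :=
  ⨅ π : {π : Measure (X × Y) // IsPlan X Y π}, gwFunctional X Y π.1

/-- `π ∈ Π_o(𝕏, 𝕐)`: the plan `π` attains the Gromov–Wasserstein distance. -/
structure IsOptimal (X Y : GMSpace.{u}) (π : Measure (X × Y)) : Prop where
  isPlan : IsPlan X Y π
  eq_gwDist : gwFunctional X Y π = gwDist X Y

/-- `γ ∈ Γ_𝕏(π₁, π₂)`: a gluing of `π₁ ∈ Π(𝕏, 𝕐)` and `π₂ ∈ Π(𝕏, 𝕎)` along `𝕏`, where `𝕎` is the third space. -/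
structure IsGluing₂ (X Y Z : GMSpace.{u}) (π₁ : Measure (X × Y)) (π₂ : Measure (X × Z))
    (γ : Measure (X × Y × Z)) : Prop where
  prob : IsProbabilityMeasure γ
  left : γ.map (fun p => (p.1, p.2.1)) = π₁
  right : γ.map (fun p => (p.1, p.2.2)) = π₂

/-- The set `M_𝕏(π₁, π₂)` of meltings of `π₁` and `π₂` along `𝕏`. -/
def meltings (X Y Z : GMSpace.{u}) (π₁ : Measure (X × Y)) (π₂ : Measure (X × Z)) :
    Set (Measure (Y × Z)) :=
  {π | ∃ γ, IsGluing₂ X Y Z π₁ π₂ γ ∧ π = γ.map Prod.snd}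

/-- `π₁ ≃_𝕏 π₂`: two optimal plans that arise from each other by melting with an optimal
self-coupling of `𝕏`. -/
structure PlanEquiv (X Y : GMSpace.{u}) (π₁ π₂ : Measure (X × Y)) : Prop where
  left : IsOptimal X Y π₁
  right : IsOptimal X Y π₂
  melt : ∃ σ : Measure (X × X), IsOptimal X X σ ∧ π₁ ∈ meltings X X Y σ π₂

/-- `γ ∈ Γ_𝕐(π₁, …, π_N)`: a multi-marginal gluing along `𝕐`. The condition `fst` is implied by
the others if `N ≥ 1` and the `π_i` are plans. -/
structure IsGluing {N : ℕ} (Y : GMSpace.{u}) (X : Fin N → GMSpace.{u})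
    (π : ∀ i, Measure (Y × X i)) (γ : Measure (Y × (∀ i, X i))) : Prop where
  prob : IsProbabilityMeasure γ
  fst : γ.map Prod.fst = Y.measure
  marginal : ∀ i, γ.map (fun p => (p.1, p.2 i)) = π i

section Plans

variable {X Y Z : GMSpace.{u}}

theorem IsPlan.mp_fst {π : Measure (X × Y)} (h : IsPlan X Y π) :
    MeasurePreserving Prod.fst π X.measure := ⟨measurable_fst, h.fst⟩

theorem IsPlan.mp_snd {π : Measure (X × Y)} (h : IsPlan X Y π) :
    MeasurePreserving Prod.snd π Y.measure := ⟨measurable_snd, h.snd⟩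

theorem IsPlan.diag (X : GMSpace.{u}) : IsPlan X X (X.measure.map fun x => (x, x)) where
  prob := Measure.isProbabilityMeasure_map (by fun_prop)
  fst := by
    rw [Measure.map_map (by fun_prop) (by fun_prop)]
    exact Measure.map_id
  snd := by
    rw [Measure.map_map (by fun_prop) (by fun_prop)]
    exact Measure.map_id

theorem IsPlan.swap {π : Measure (X × Y)} (h : IsPlan X Y π) : IsPlan Y X (π.map Prod.swap) where
  prob := by
    have := h.prob
    exact Measure.isProbabilityMeasure_map (by fun_prop)
  fst := by
    rw [Measure.map_map (by fun_prop) (by fun_prop)]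
    exact h.snd
  snd := by
    rw [Measure.map_map (by fun_prop) (by fun_prop)]
    exact h.fst

theorem aesm_discrepancy {π : Measure (X × Y)} (h : IsPlan X Y π) {f : X × X → ℝ} {f' : Y × Y → ℝ}
    (hf : IsGauge f X.measure) (hf' : IsGauge f' Y.measure) :
    AEStronglyMeasurable
      (fun p : (X × Y) × (X × Y) => f (p.1.1, p.2.1) - f' (p.1.2, p.2.2)) (π.prod π) := by
  have := h.prob
  exact (hf.pull h.mp_fst).memLp.1.sub (hf'.pull h.mp_snd).memLp.1

theorem discrepancy_map {W : Type*} [MeasurableSpace W] {ω : Measure W} [IsProbabilityMeasure ω]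
    {a : W → X} {b : W → Y} (ha : Measurable a) (hb : Measurable b)
    (h : IsPlan X Y (ω.map fun w => (a w, b w))) {f : X × X → ℝ} {f' : Y × Y → ℝ}
    (hf : IsGauge f X.measure) (hf' : IsGauge f' Y.measure) :
    discrepancy f f' (ω.map fun w => (a w, b w)) =
      eLpNorm (fun p : W × W => f (a p.1, a p.2) - f' (b p.1, b p.2)) 2 (ω.prod ω) := by
  have := h.prob
  have hm : MeasurePreserving (fun w => (a w, b w)) ω (ω.map fun w => (a w, b w)) :=
    ⟨by fun_prop, rfl⟩
  exact (eLpNorm_comp_measurePreserving (aesm_discrepancy h hf hf')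
    (measurePreserving_pair hm)).symm

theorem discrepancy_diag {f : X × X → ℝ} (hf : IsGauge f X.measure) :
    discrepancy f f (X.measure.map fun x => (x, x)) = 0 := by
  rw [discrepancy_map (a := fun x => x) (b := fun x => x) measurable_id measurable_id
    (IsPlan.diag X) hf hf]
  simp

theorem discrepancy_swap {π : Measure (X × Y)} (h : IsPlan X Y π) {f : X × X → ℝ}
    {f' : Y × Y → ℝ} (hf : IsGauge f X.measure) (hf' : IsGauge f' Y.measure) :
    discrepancy f' f (π.map Prod.swap) = discrepancy f f' π := by
  have := h.prob
  refine (discrepancy_map (a := Prod.snd) (b := Prod.fst) measurable_snd measurable_fst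
    h.swap hf' hf).trans ?_
  exact eLpNorm_sub_comm _ _ _ _

theorem discrepancy_eq_zero_iff {π : Measure (X × Y)} (h : IsPlan X Y π) {f : X × X → ℝ}
    {f' : Y × Y → ℝ} (hf : IsGauge f X.measure) (hf' : IsGauge f' Y.measure) :
    discrepancy f f' π = 0 ↔
      ∀ᵐ p ∂(π.prod π), f (p.1.1, p.2.1) = f' (p.1.2, p.2.2) := by
  rw [discrepancy, eLpNorm_eq_zero_iff (aesm_discrepancy h hf hf') (by norm_num)]
  simp only [Filter.EventuallyEq, Pi.zero_apply, sub_eq_zero]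

/-- Gluing: two plans with a common middle space compose, and all discrepancies satisfy the
triangle inequality along the composition. -/
theorem exists_comp {π₁ : Measure (X × Y)} {π₂ : Measure (Y × Z)} (h₁ : IsPlan X Y π₁)
    (h₂ : IsPlan Y Z π₂) : ∃ π : Measure (X × Z), IsPlan X Z π ∧
      ∀ (a : X × X → ℝ) (b : Y × Y → ℝ) (c : Z × Z → ℝ), IsGauge a X.measure →
        IsGauge b Y.measure → IsGauge c Z.measure →
        discrepancy a c π ≤ discrepancy a b π₁ + discrepancy b c π₂ := by
  have := h₁.swap.prob
  have := h₁.prob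
  have := h₂.prob
  have : Nonempty X := X.measure.nonempty_of_neZero
  have : Nonempty Z := Z.measure.nonempty_of_neZero
  set κ₁ := (π₁.map Prod.swap).condKernel with hκ₁
  set κ₂ := π₂.condKernel with hκ₂
  set ω : Measure (Y × X × Z) := Y.measure ⊗ₘ (κ₁ ×ₖ κ₂) with hω
  have e₁ : Y.measure ⊗ₘ κ₁ = π₁.map Prod.swap := by
    have h : (π₁.map Prod.swap).fst = Y.measure := h₁.swap.fst
    rw [← h]; exact Measure.disintegrate _ _
  have e₂ : Y.measure ⊗ₘ κ₂ = π₂ := by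
    have h : π₂.fst = Y.measure := h₂.fst
    rw [← h]; exact Measure.disintegrate _ _
  have m₁ : ω.map (fun p => (p.1, p.2.1)) = π₁.map Prod.swap := by
    rw [← e₁, ← Kernel.fst_prod κ₁ κ₂, Kernel.fst_eq, Measure.compProd_map measurable_fst]
    rfl
  have m₂ : ω.map (fun p => (p.1, p.2.2)) = π₂ := by
    rw [← e₂, ← Kernel.snd_prod κ₁ κ₂, Kernel.snd_eq, Measure.compProd_map measurable_snd]
    rfl
  have m₁' : ω.map (fun p => (p.2.1, p.1)) = π₁ := by
    have := congrArg (Measure.map Prod.swap) m₁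
    rw [Measure.map_map (by fun_prop) (by fun_prop),
      Measure.map_map (by fun_prop) (by fun_prop)] at this
    refine Eq.trans ?_ (this.trans ?_)
    · rfl
    · rw [Prod.swap_swap_eq, Measure.map_id]
  have hp : IsPlan X Z (ω.map fun p => (p.2.1, p.2.2)) := by
    refine ⟨Measure.isProbabilityMeasure_map (by fun_prop), ?_, ?_⟩
    · rw [← h₁.fst, ← m₁', Measure.map_map (by fun_prop) (by fun_prop),
        Measure.map_map (by fun_prop) (by fun_prop)]
      rfl
    · rw [← h₂.snd, ← m₂, Measure.map_map (by fun_prop) (by fun_prop),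
        Measure.map_map (by fun_prop) (by fun_prop)]
      rfl
  refine ⟨_, hp, fun a b c ha hb hc => ?_⟩
  have d₁ := discrepancy_map (ω := ω) (a := fun p => p.2.1) (b := fun p => p.1) (by fun_prop)
    (by fun_prop) (by rw [m₁']; exact h₁) ha hb
  have d₂ := discrepancy_map (ω := ω) (a := fun p => p.1) (b := fun p => p.2.2) (by fun_prop)
    (by fun_prop) (by rw [m₂]; exact h₂) hb hc
  rw [m₁'] at d₁
  rw [m₂] at d₂
  rw [discrepancy_map (by fun_prop) (by fun_prop) hp ha hc, d₁, d₂]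
  have pX : MeasurePreserving (fun p : Y × X × Z => p.2.1) ω X.measure :=
    ⟨by fun_prop, by
      rw [← h₁.fst, ← m₁', Measure.map_map (by fun_prop) (by fun_prop)]; rfl⟩
  have pY : MeasurePreserving (fun p : Y × X × Z => p.1) ω Y.measure :=
    ⟨by fun_prop, by
      rw [← h₂.fst, ← m₂, Measure.map_map (by fun_prop) (by fun_prop)]; rfl⟩
  have pZ : MeasurePreserving (fun p : Y × X × Z => p.2.2) ω Z.measure :=
    ⟨by fun_prop, by
      rw [← h₂.snd, ← m₂, Measure.map_map (by fun_prop) (by fun_prop)]; rfl⟩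
  have key := eLpNorm_add_le (μ := ω.prod ω) (p := 2)
    ((ha.pull pX).memLp.1.sub (hb.pull pY).memLp.1)
    ((hb.pull pY).memLp.1.sub (hc.pull pZ).memLp.1) (by norm_num)
  rw [sub_add_sub_cancel] at key
  exact key

theorem gwDist_le {π : Measure (X × Y)} (h : IsPlan X Y π) :
    gwDist X Y ≤ discrepancy X.gauge Y.gauge π :=
  iInf_le (fun π : {π : Measure (X × Y) // IsPlan X Y π} => gwFunctional X Y π.1) ⟨π, h⟩

theorem gwDist_self (X : GMSpace.{u}) : gwDist X X = 0 := by
  refine le_antisymm ?_ bot_le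
  rw [← discrepancy_diag X.isGauge]
  exact gwDist_le (IsPlan.diag X)

theorem gwDist_le_swap (X Y : GMSpace.{u}) : gwDist Y X ≤ gwDist X Y := by
  refine le_iInf fun π => ?_
  rw [gwFunctional, ← discrepancy_swap π.2 X.isGauge Y.isGauge]
  exact gwDist_le π.2.swap

theorem gwDist_comm (X Y : GMSpace.{u}) : gwDist X Y = gwDist Y X :=
  le_antisymm (gwDist_le_swap _ _) (gwDist_le_swap _ _)

theorem gwDist_triangle (X Y Z : GMSpace.{u}) : gwDist X Z ≤ gwDist X Y + gwDist Y Z := by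
  conv_rhs => rw [gwDist, gwDist, ENNReal.iInf_add]
  refine le_iInf fun π₁ => ?_
  rw [ENNReal.add_iInf]
  refine le_iInf fun π₂ => ?_
  obtain ⟨π, hπ, h⟩ := exists_comp π₁.2 π₂.2
  exact (gwDist_le hπ).trans (h _ _ _ X.isGauge Y.isGauge Z.isGauge)

end Plans

/-- Homomorphy `𝕏 ≃ 𝕐`, i.e. `GW(𝕏, 𝕐) = 0`. -/
instance homSetoid : Setoid GMSpace.{u} where
  r X Y := gwDist X Y = 0
  iseqv :=
    { refl := gwDist_self
      symm := fun {X Y} h => (gwDist_comm Y X).trans h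
      trans := fun {X Y Z} h₁ h₂ => by
        have := gwDist_triangle X Y Z
        rw [h₁, h₂, add_zero] at this
        exact le_antisymm this bot_le }

/-- The space `𝔊𝔐` of homomorphic classes of gauged measure spaces. -/
def GMClass : Type (u + 1) := Quotient homSetoid.{u}

/-- The homomorphic class `⟦𝕏⟧`. -/
def GMSpace.toClass (X : GMSpace.{u}) : GMClass.{u} := Quotient.mk homSetoid X

theorem toClass_eq_iff {X Y : GMSpace.{u}} : X.toClass = Y.toClass ↔ gwDist X Y = 0 :=
  Quotient.eq

/-- An element `f|_𝕐` of the disjoint union of the gauge spaces `L²_sym(Y × Y, υ ⊗ υ)` over all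
representatives `𝕐 = (Y, h, υ)` of the class `𝔜`. -/
structure TangentRep (𝔜 : GMClass.{u}) where
  base : GMSpace.{u}
  base_mem : base.toClass = 𝔜
  toFun : base × base → ℝ
  isGauge : IsGauge toFun base.measure

namespace TangentRep

variable {𝔜 : GMClass.{u}}

/-- `f ≃ f'`: the two gauges agree almost everywhere along some optimal plan of their bases. -/
def Equivalent (f f' : TangentRep 𝔜) : Prop :=
  ∃ τ : Measure (f.base × f'.base), IsOptimal f.base f'.base τ ∧
    ∀ᵐ p ∂(τ.prod τ), f.toFun (p.1.1, p.2.1) = f'.toFun (p.1.2, p.2.2)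

/-- The tangent metric on representatives. -/
def dist (f f' : TangentRep 𝔜) : ℝ≥0∞ :=
  ⨅ τ : {τ : Measure (f.base × f'.base) // IsOptimal f.base f'.base τ},
    discrepancy f.toFun f'.toFun τ.1

theorem gwDist_eq_zero (f f' : TangentRep 𝔜) : gwDist f.base f'.base = 0 :=
  toClass_eq_iff.1 (f.base_mem.trans f'.base_mem.symm)

theorem isOptimal_iff (f f' : TangentRep 𝔜) {τ : Measure (f.base × f'.base)} :
    IsOptimal f.base f'.base τ ↔
      IsPlan f.base f'.base τ ∧ discrepancy f.base.gauge f'.base.gauge τ = 0 := by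
  rw [← gwDist_eq_zero f f']
  exact ⟨fun h => ⟨h.1, h.2⟩, fun h => ⟨h.1, h.2⟩⟩

theorem exists_comp_optimal {f₁ f₂ f₃ : TangentRep 𝔜} {τ₁ : Measure (f₁.base × f₂.base)}
    {τ₂ : Measure (f₂.base × f₃.base)} (h₁ : IsOptimal f₁.base f₂.base τ₁)
    (h₂ : IsOptimal f₂.base f₃.base τ₂) :
    ∃ τ : Measure (f₁.base × f₃.base), IsOptimal f₁.base f₃.base τ ∧
      discrepancy f₁.toFun f₃.toFun τ ≤
        discrepancy f₁.toFun f₂.toFun τ₁ + discrepancy f₂.toFun f₃.toFun τ₂ := by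
  obtain ⟨τ, hτ, h⟩ := exists_comp h₁.1 h₂.1
  refine ⟨τ, (isOptimal_iff f₁ f₃).2 ⟨hτ, ?_⟩, h _ _ _ f₁.isGauge f₂.isGauge f₃.isGauge⟩
  have := h _ _ _ f₁.base.isGauge f₂.base.isGauge f₃.base.isGauge
  rw [((isOptimal_iff f₁ f₂).1 h₁).2, ((isOptimal_iff f₂ f₃).1 h₂).2, add_zero] at this
  exact le_antisymm this bot_le

theorem equivalent_iff {f f' : TangentRep 𝔜} : f.Equivalent f' ↔
    ∃ τ, IsOptimal f.base f'.base τ ∧ discrepancy f.toFun f'.toFun τ = 0 :=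
  exists_congr fun _ => and_congr_right fun h =>
    (discrepancy_eq_zero_iff h.1 f.isGauge f'.isGauge).symm

theorem Equivalent.refl (f : TangentRep 𝔜) : f.Equivalent f :=
  equivalent_iff.2 ⟨_, (isOptimal_iff f f).2 ⟨IsPlan.diag _, discrepancy_diag f.base.isGauge⟩,
    discrepancy_diag f.isGauge⟩

theorem Equivalent.symm {f f' : TangentRep 𝔜} (h : f.Equivalent f') : f'.Equivalent f := by
  obtain ⟨τ, hτ, h0⟩ := equivalent_iff.1 h
  refine equivalent_iff.2 ⟨τ.map Prod.swap, (isOptimal_iff f' f).2 ⟨hτ.1.swap, ?_⟩, ?_⟩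
  · rw [discrepancy_swap hτ.1 f.base.isGauge f'.base.isGauge]
    exact ((isOptimal_iff f f').1 hτ).2
  · rw [discrepancy_swap hτ.1 f.isGauge f'.isGauge, h0]

theorem Equivalent.trans {f₁ f₂ f₃ : TangentRep 𝔜} (h : f₁.Equivalent f₂)
    (h' : f₂.Equivalent f₃) : f₁.Equivalent f₃ := by
  obtain ⟨τ₁, hτ₁, h1⟩ := equivalent_iff.1 h
  obtain ⟨τ₂, hτ₂, h2⟩ := equivalent_iff.1 h'
  obtain ⟨τ, hτ, h3⟩ := exists_comp_optimal hτ₁ hτ₂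
  rw [h1, h2, add_zero] at h3
  exact equivalent_iff.2 ⟨τ, hτ, le_antisymm h3 bot_le⟩

theorem dist_le {f f' : TangentRep 𝔜} {τ : Measure (f.base × f'.base)}
    (h : IsOptimal f.base f'.base τ) : f.dist f' ≤ discrepancy f.toFun f'.toFun τ :=
  iInf_le (fun τ : {τ : Measure (f.base × f'.base) // IsOptimal f.base f'.base τ} =>
    discrepancy f.toFun f'.toFun τ.1) ⟨τ, h⟩

theorem dist_triangle (f₁ f₂ f₃ : TangentRep 𝔜) : f₁.dist f₃ ≤ f₁.dist f₂ + f₂.dist f₃ := by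
  conv_rhs => rw [dist, dist, ENNReal.iInf_add]
  refine le_iInf fun τ₁ => ?_
  rw [ENNReal.add_iInf]
  refine le_iInf fun τ₂ => ?_
  obtain ⟨τ, hτ, h⟩ := exists_comp_optimal τ₁.2 τ₂.2
  exact (dist_le hτ).trans h

theorem Equivalent.dist_eq_zero {f f' : TangentRep 𝔜} (h : f.Equivalent f') : f.dist f' = 0 := by
  obtain ⟨τ, hτ, h0⟩ := equivalent_iff.1 h
  refine le_antisymm ?_ bot_le
  rw [← h0]
  exact dist_le hτ

theorem Equivalent.dist_le {f₁ f₂ g₁ g₂ : TangentRep 𝔜} (h : f₁.Equivalent g₁)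
    (h' : f₂.Equivalent g₂) : f₁.dist f₂ ≤ g₁.dist g₂ := by
  calc f₁.dist f₂ ≤ f₁.dist g₁ + g₁.dist f₂ := dist_triangle _ _ _
    _ ≤ f₁.dist g₁ + (g₁.dist g₂ + g₂.dist f₂) := by gcongr; exact dist_triangle _ _ _
    _ = g₁.dist g₂ := by rw [h.dist_eq_zero, h'.symm.dist_eq_zero, zero_add, add_zero]

instance setoid (𝔜 : GMClass.{u}) : Setoid (TangentRep 𝔜) :=
  ⟨Equivalent, Equivalent.refl, Equivalent.symm, Equivalent.trans⟩

end TangentRep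

/-- The tangent space `𝔗_𝔜`. -/
def TangentSpace (𝔜 : GMClass.{u}) : Type (u + 1) := Quotient (TangentRep.setoid 𝔜)

/-- The class `⟦f|_𝕐⟧` in the tangent space. -/
def TangentRep.toTangent {𝔜 : GMClass.{u}} (f : TangentRep 𝔜) : TangentSpace 𝔜 :=
  Quotient.mk (TangentRep.setoid 𝔜) f

/-- The tangent metric `d_{𝔗_𝔜}`, with values in `[0, ∞]`. -/
def tangentDist {𝔜 : GMClass.{u}} : TangentSpace 𝔜 → TangentSpace 𝔜 → ℝ≥0∞ :=
  Quotient.lift₂ TangentRep.dist fun _ _ _ _ h h' =>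
    le_antisymm (TangentRep.Equivalent.dist_le h h')
      (TangentRep.Equivalent.dist_le (TangentRep.Equivalent.symm h)
        (TangentRep.Equivalent.symm h'))

/-- The gauged measure space `(Y × Z, h, γ)` for `𝕐 = (Y, h, υ)` and a probability measure `γ` on
`Y × Z` with first marginal `υ`; here `h` is pulled back from `Y`. -/
def GMSpace.over (Y : GMSpace.{u}) {Z : Type u} [TopologicalSpace Z] [PolishSpace Z]
    [MeasurableSpace Z] [BorelSpace Z] (γ : Measure (Y × Z)) (hp : IsProbabilityMeasure γ)
    (hγ : γ.map Prod.fst = Y.measure) : GMSpace.{u} where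
  carrier := Y × Z
  gauge := pull Prod.fst Y.gauge
  measure := γ
  isGauge := Y.isGauge.pull ⟨measurable_fst, hγ⟩

theorem GMSpace.over_toClass (Y : GMSpace.{u}) {Z : Type u} [TopologicalSpace Z] [PolishSpace Z]
    [MeasurableSpace Z] [BorelSpace Z] (γ : Measure (Y × Z)) (hp : IsProbabilityMeasure γ)
    (hγ : γ.map Prod.fst = Y.measure) : (Y.over γ hp hγ).toClass = Y.toClass := by
  have hm : Measurable (fun p : Y × Z => (p, p.1)) := by fun_prop
  have h : IsPlan (Y.over γ hp hγ) Y (γ.map fun p : Y × Z => (p, p.1)) := by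
    refine ⟨Measure.isProbabilityMeasure_map hm.aemeasurable, ?_, ?_⟩
    · exact (Measure.map_map measurable_fst hm).trans Measure.map_id
    · exact (Measure.map_map measurable_snd hm).trans hγ
  refine toClass_eq_iff.2 (le_antisymm ((gwDist_le h).trans (le_of_eq ?_)) bot_le)
  refine (discrepancy_map (W := Y × Z) (ω := γ) (X := Y.over γ hp hγ) (Y := Y)
    (a := fun p => p) (b := Prod.fst) measurable_id measurable_fst h
    (Y.over γ hp hγ).isGauge Y.isGauge).trans ?_
  have h0 : (fun p : (Y × Z) × (Y × Z) =>
      (Y.over γ hp hγ).gauge (p.1, p.2) - Y.gauge (p.1.1, p.2.1)) = 0 :=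
    funext fun p => sub_self (Y.gauge (p.1.1, p.2.1))
  exact (congrArg (fun F => eLpNorm F 2 (γ.prod γ)) h0).trans eLpNorm_zero

/-- The lifting `⟦(g - h)|_{(Y × X, h, π)}⟧` of `𝕏 = (X, g, ξ)` into the tangent space at
`𝕐 = (Y, h, υ)` along a plan `π`. -/
def lift (Y X : GMSpace.{u}) (π : Measure (Y × X)) (hπ : IsPlan Y X π) :
    TangentSpace Y.toClass :=
  TangentRep.toTangent
    { base := Y.over π hπ.prob hπ.fst
      base_mem := Y.over_toClass π hπ.prob hπ.fst
      toFun := pull Prod.snd X.gauge - pull Prod.fst Y.gauge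
      isGauge :=
        have := hπ.prob
        (X.isGauge.pull hπ.mp_snd).sub (Y.isGauge.pull hπ.mp_fst) }

/-- The mean gauge `m_ρ(x, x') = ∑ᵢ ρᵢ gᵢ(xᵢ, xᵢ')` on `X_× = X₁ × ⋯ × X_N`. -/
def meanGauge {N : ℕ} (X : Fin N → GMSpace.{u}) (ρ : Fin N → ℝ) :
    (∀ i, X i) × (∀ i, X i) → ℝ :=
  fun p => ∑ i, ρ i * (X i).gauge (p.1 i, p.2 i)

theorem IsGluing.mp_coord {N : ℕ} {Y : GMSpace.{u}} {X : Fin N → GMSpace.{u}}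
    {π : ∀ i, Measure (Y × X i)} {γ : Measure (Y × (∀ i, X i))} (hγ : IsGluing Y X π γ)
    (hπ : ∀ i, IsPlan Y (X i) (π i)) (i : Fin N) :
    MeasurePreserving (fun p : Y × (∀ i, X i) => p.2 i) γ (X i).measure := by
  refine ⟨by fun_prop, ?_⟩
  rw [← (hπ i).snd, ← hγ.marginal i, Measure.map_map (by fun_prop) (by fun_prop)]
  rfl

/-- The tangent `⟦(m_ρ - h)|_{(Y × X_×, h, γ)}⟧` for a gluing `γ` of plans `π_i ∈ Π(𝕐, 𝕏_i)`. -/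
def meanTangent {N : ℕ} (Y : GMSpace.{u}) (X : Fin N → GMSpace.{u}) (ρ : Fin N → ℝ)
    (π : ∀ i, Measure (Y × X i)) (hπ : ∀ i, IsPlan Y (X i) (π i))
    (γ : Measure (Y × (∀ i, X i))) (hγ : IsGluing Y X π γ) : TangentSpace Y.toClass :=
  TangentRep.toTangent
    { base := Y.over γ hγ.prob hγ.fst
      base_mem := Y.over_toClass γ hγ.prob hγ.fst
      toFun := pull Prod.snd (meanGauge X ρ) - pull Prod.fst Y.gauge
      isGauge :=
        have := hγ.prob
        (IsGauge.weightedSum ρ fun i => (X i).isGauge.pull (hγ.mp_coord hπ i)).sub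
          (Y.isGauge.pull ⟨measurable_fst, hγ.fst⟩) }

/-- The tangential barycenter loss `∑ᵢ ρᵢ d²(𝔤ᵢ, 𝔣)`, for weights `ρᵢ ≥ 0`. -/
def barycenterLoss {N : ℕ} {𝔜 : GMClass.{u}} (ρ : Fin N → ℝ) (𝔤 : Fin N → TangentSpace 𝔜)
    (𝔣 : TangentSpace 𝔜) : ℝ≥0∞ :=
  ∑ i, ENNReal.ofReal (ρ i) * tangentDist (𝔤 i) 𝔣 ^ 2

/-- The value of the tangential barycenter problem. -/
def barycenterValue {N : ℕ} {𝔜 : GMClass.{u}} (ρ : Fin N → ℝ) (𝔤 : Fin N → TangentSpace 𝔜) :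
    ℝ≥0∞ :=
  ⨅ 𝔣 : TangentSpace 𝔜, barycenterLoss ρ 𝔤 𝔣

/-- `𝔣` solves the tangential barycenter problem. -/
def IsTangentialBarycenter {N : ℕ} {𝔜 : GMClass.{u}} (ρ : Fin N → ℝ)
    (𝔤 : Fin N → TangentSpace 𝔜) (𝔣 : TangentSpace 𝔜) : Prop :=
  barycenterLoss ρ 𝔤 𝔣 = barycenterValue ρ 𝔤

end

end GromovWasserstein

open GromovWasserstein

/-! The problem reduces to a multi-marginal one. Call a coupling `P` of `π₁, …, π_N` on `∏ i, Y × X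
i` admissible if the `N` pullbacks of the gauge `h` of `Y` agree `P ⊗ P`-a.e., and let its spread be
the weighted sum of the squared `L²(P ⊗ P)` distances of the `gᵢ` from their mean `m_ρ`. The minimal
spread is the value of the barycenter problem.

Lower bound (`exists_admissible_spread_le`, `le_barycenterLoss`): let a tangent `f` have base `W`.
Plans of zero cost from the `(Y × X i, h, π i)` to `W` can be glued along `W`. All copies of `h`
then agree with the gauge of `W`, so the law of the remaining coordinates is admissible. The
integrand of the loss is `∑ ρᵢ (gᵢ - c)²` with `c` independent of `i`, and the choice `c = m_ρ`
minimizes it pointwise.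

Attainment (`exists_spread_le`): the admissible couplings form a compact set by Prokhorov's theorem,
and the spread is continuous on it. The gauges are only square integrable, but each depends on
coordinates of fixed law, so bounded continuous kernels approximate it uniformly over all couplings.

Upper bound (`barycenterLoss_meanTangent_le`, `planEquiv_of_admissible`): keep only the `i₀`-th
`Y`-coordinate of a minimizer. This gives a gluing of plans equivalent to the `π i`. The minimizer
itself supplies zero-cost plans to the mean tangent, along which the copies of `h` cancel and the
loss becomes the spread. -/

namespace GromovWasserstein

open Filter Topology Set

/-! ### Gluing finitely many couplings along a common marginal. -/

section Gluing

variable {ι W : Type*} [Fintype ι] [MeasurableSpace W] {Z : ι → Type*}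
  [∀ i, MeasurableSpace (Z i)]

theorem measurable_measure_pi (κ : ∀ i, Kernel W (Z i)) [∀ i, IsMarkovKernel (κ i)] :
    Measurable fun w => Measure.pi fun i => κ i w := by
  refine Measurable.measure_of_isPiSystem_of_isProbabilityMeasure generateFrom_pi.symm
    isPiSystem_pi ?_
  rintro _ ⟨s, hs, rfl⟩
  simp only [Measure.pi_pi]
  exact Finset.measurable_fun_prod _ fun i _ => (κ i).measurable_coe (hs i (mem_univ i))

/-- Finitely many couplings with a common first marginal are the two-dimensional marginals of a
single measure. -/
theorem exists_common_gluing [∀ i, StandardBorelSpace (Z i)] (μ : Measure W)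
    [IsProbabilityMeasure μ] (τ : ∀ i, Measure (W × Z i)) (hp : ∀ i, IsProbabilityMeasure (τ i))
    (h : ∀ i, (τ i).map Prod.fst = μ) :
    ∃ ω : Measure (W × ∀ i, Z i), IsProbabilityMeasure ω ∧
      ∀ i, ω.map (fun p => (p.1, p.2 i)) = τ i := by
  have (i : ι) : Nonempty (Z i) := by
    obtain ⟨p⟩ := (τ i).nonempty_of_neZero
    exact ⟨p.2⟩
  -- Given the `W`-coordinate, the other coordinates are made independent, each with the conditional
  -- law from `τ i`.
  let κ : Kernel W (∀ i, Z i) :=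
    ⟨fun w => Measure.pi fun i => (τ i).condKernel w, measurable_measure_pi _⟩
  have hκ : IsMarkovKernel κ := ⟨fun w => inferInstanceAs
    (IsProbabilityMeasure (Measure.pi fun i => (τ i).condKernel w))⟩
  refine ⟨μ ⊗ₘ κ, inferInstance, fun i => ?_⟩
  have h1 : κ.map (fun z => z i) = (τ i).condKernel := by
    ext1 w
    rw [Kernel.map_apply _ (measurable_pi_apply i)]
    exact (measurePreserving_eval (fun i => (τ i).condKernel w) i).map_eq
  have h2 : μ ⊗ₘ (τ i).condKernel = τ i := by
    rw [← h i]; exact (τ i).disintegrate _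
  rw [← h2, ← h1, Measure.compProd_map (measurable_pi_apply i)]
  rfl

end Gluing

/-! ### Weak compactness of the couplings with prescribed marginals. -/

section Compactness

variable {ι : Type*} [Fintype ι] {Z : ι → Type*} [∀ i, TopologicalSpace (Z i)]
  [∀ i, PolishSpace (Z i)] [∀ i, MeasurableSpace (Z i)] [∀ i, BorelSpace (Z i)]

/-- The probability measures on a finite product with prescribed marginals. -/
def withMarginals (π : ∀ i, Measure (Z i)) : Set (ProbabilityMeasure (∀ i, Z i)) :=
  {P | ∀ i, (P : Measure (∀ i, Z i)).map (fun z => z i) = π i}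

/-- The mass outside a product of compacts is at most the sum of the masses the marginals put
outside the factors. These are the same for every coupling, so it suffices to split `ε` among the
coordinates. -/
theorem isTightMeasureSet_withMarginals (π : ∀ i, Measure (Z i))
    [∀ i, IsProbabilityMeasure (π i)] :
    IsTightMeasureSet {((P : ProbabilityMeasure (∀ i, Z i)) : Measure (∀ i, Z i)) |
      P ∈ withMarginals π} := by
  rw [isTightMeasureSet_iff_exists_isCompact_measure_compl_le]
  intro ε hε
  obtain ⟨δ, hδ, hδε⟩ := ENNReal.exists_pos_sum_of_countable' hε.ne' ι
  have hK (i : ι) : ∃ K : Set (Z i), IsCompact K ∧ π i Kᶜ ≤ δ i := by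
    let := TopologicalSpace.upgradeIsCompletelyMetrizable (Z i)
    obtain ⟨K, hK, h⟩ := isTightMeasureSet_iff_exists_isCompact_measure_compl_le.1
      (isTightMeasureSet_singleton (μ := π i)) (δ i) (hδ i)
    exact ⟨K, hK, h _ rfl⟩
  choose K hK hKδ using hK
  refine ⟨univ.pi K, isCompact_univ_pi hK, ?_⟩
  rintro _ ⟨P, hP, rfl⟩
  have hsub : (univ.pi K)ᶜ ⊆ ⋃ i, (fun z : ∀ i, Z i => z i) ⁻¹' (K i)ᶜ := by
    intro z hz
    simpa [Set.mem_pi] using hz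
  calc (P : Measure (∀ i, Z i)) (univ.pi K)ᶜ
      ≤ ∑' i, (P : Measure (∀ i, Z i)) ((fun z : ∀ i, Z i => z i) ⁻¹' (K i)ᶜ) :=
        (measure_mono hsub).trans (measure_iUnion_le _)
    _ ≤ ∑' i, δ i := by
        refine ENNReal.tsum_le_tsum fun i => ?_
        rw [← Measure.map_apply (measurable_pi_apply i) (hK i).measurableSet.compl, hP i]
        exact hKδ i
    _ ≤ ε := hδε.le

theorem isClosed_withMarginals (π : ∀ i, Measure (Z i)) [∀ i, IsProbabilityMeasure (π i)] :
    IsClosed (withMarginals π) := by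
  have : withMarginals π = ⋂ i, {P | P.map (f := fun z : ∀ i, Z i => z i)
      (measurable_pi_apply i).aemeasurable = ⟨π i, inferInstance⟩} := by
    ext P
    simp only [withMarginals, mem_ofPred_eq, mem_iInter]
    exact forall_congr' fun i => ⟨fun h => Subtype.ext h, fun h => congrArg Subtype.val h⟩
  rw [this]
  refine isClosed_iInter fun i => ?_
  let := TopologicalSpace.upgradeIsCompletelyMetrizable (Z i)
  exact isClosed_eq (ProbabilityMeasure.continuous_map (continuous_apply i)) continuous_const

theorem isCompact_withMarginals (π : ∀ i, Measure (Z i)) [∀ i, IsProbabilityMeasure (π i)] :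
    IsCompact (withMarginals π) := by
  let (i : ι) := TopologicalSpace.upgradeIsCompletelyMetrizable (Z i)
  have := isCompact_closure_of_isTightMeasureSet (isTightMeasureSet_withMarginals π)
  rwa [(isClosed_withMarginals π).closure_eq] at this

end Compactness

/-! ### Weak continuity of `L²(P ⊗ P)` norms of kernels that need not be continuous. -/

section Continuity

variable {E : Type*} [TopologicalSpace E] [MeasurableSpace E]

/-- `f` is approximable by bounded continuous functions in `L²(P ⊗ P)`, uniformly in `P ∈ S`. -/
def UniformlyApproximable (S : Set (ProbabilityMeasure E)) (f : E × E → ℝ) : Prop :=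
  ∀ ε > 0, ∃ b : BoundedContinuousFunction (E × E) ℝ, ∀ P ∈ S,
    MemLp f 2 ((P : Measure E).prod (P : Measure E)) ∧
      eLpNorm (f - ⇑b) 2 ((P : Measure E).prod (P : Measure E)) ≤ ENNReal.ofReal ε

namespace UniformlyApproximable

variable {S : Set (ProbabilityMeasure E)} {f g : E × E → ℝ}

theorem memLp (hf : UniformlyApproximable S f) {P : ProbabilityMeasure E} (hP : P ∈ S) :
    MemLp f 2 ((P : Measure E).prod (P : Measure E)) := by
  obtain ⟨b, hb⟩ := hf 1 one_pos
  exact (hb P hP).1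

theorem zero : UniformlyApproximable S (0 : E × E → ℝ) :=
  fun ε _ => ⟨0, fun P _ => ⟨MemLp.zero', by simp⟩⟩

theorem const_smul (c : ℝ) (hf : UniformlyApproximable S f) :
    UniformlyApproximable S (c • f) := by
  intro ε hε
  have hc : 0 < |c| + 1 := by positivity
  -- The `+ 1` keeps the tolerance positive when `c = 0`.
  obtain ⟨b, hb⟩ := hf (ε / (|c| + 1)) (by positivity)
  refine ⟨c • b, fun P hP => ⟨(hb P hP).1.const_smul c, ?_⟩⟩
  have e : c • f - ⇑(c • b) = c • (f - ⇑b) := by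
    rw [BoundedContinuousFunction.coe_smul, smul_sub]; rfl
  rw [e, eLpNorm_const_smul, Real.enorm_eq_ofReal_abs]
  refine (mul_le_mul_right (hb P hP).2 _).trans ?_
  rw [← ENNReal.ofReal_mul (abs_nonneg c)]
  refine ENNReal.ofReal_le_ofReal ?_
  rw [mul_div_assoc', div_le_iff₀ hc]
  nlinarith [abs_nonneg c]

variable [PolishSpace E] [BorelSpace E]

theorem memLp_bcf (b : BoundedContinuousFunction (E × E) ℝ) (μ : Measure (E × E))
    [IsFiniteMeasure μ] : MemLp b 2 μ :=
  MemLp.of_bound b.continuous.aestronglyMeasurable ‖b‖ (ae_of_all _ b.norm_coe_le_norm)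

theorem add (hf : UniformlyApproximable S f) (hg : UniformlyApproximable S g) :
    UniformlyApproximable S (f + g) := by
  intro ε hε
  obtain ⟨b, hb⟩ := hf (ε / 2) (half_pos hε)
  obtain ⟨c, hc⟩ := hg (ε / 2) (half_pos hε)
  refine ⟨b + c, fun P hP => ⟨(hb P hP).1.add (hc P hP).1, ?_⟩⟩
  have e : f + g - ⇑(b + c) = (f - b) + (g - c) := by
    rw [BoundedContinuousFunction.coe_add]; abel
  rw [e]
  refine (eLpNorm_add_le ((hb P hP).1.sub (memLp_bcf b _)).1
    ((hc P hP).1.sub (memLp_bcf c _)).1 (by norm_num)).trans ?_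
  refine (add_le_add (hb P hP).2 (hc P hP).2).trans ?_
  rw [← ENNReal.ofReal_add (half_pos hε).le (half_pos hε).le, add_halves]

theorem sub (hf : UniformlyApproximable S f) (hg : UniformlyApproximable S g) :
    UniformlyApproximable S (f - g) := by
  have := hf.add (hg.const_smul (-1))
  rwa [neg_one_smul, ← sub_eq_add_neg] at this

theorem sum {ι : Type*} (s : Finset ι) {F : ι → E × E → ℝ}
    (hF : ∀ i, UniformlyApproximable S (F i)) : UniformlyApproximable S (∑ i ∈ s, F i) :=
  Finset.sum_induction _ _ (fun _ _ => add) zero fun i _ => hF i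

/-- Square-integrable kernels pulled back from a factor with a fixed marginal. -/
theorem pull_of_map_eq {Z : Type*} [TopologicalSpace Z] [PolishSpace Z] [MeasurableSpace Z]
    [BorelSpace Z] {ζ : Measure Z} [IsProbabilityMeasure ζ] {φ : E → Z} (hφ : Continuous φ)
    (hS : ∀ P ∈ S, (P : Measure E).map φ = ζ) {k : Z × Z → ℝ} (hk : MemLp k 2 (ζ.prod ζ)) :
    UniformlyApproximable S (pull φ k) := by
  intro ε hε
  let := TopologicalSpace.upgradeIsCompletelyMetrizable Z
  -- A single approximant on `Z × Z` serves all `P ∈ S`: pulling back along `φ` turns the `ζ ⊗ ζ`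
  -- norm into the `P ⊗ P` norm.
  obtain ⟨b, hb, -⟩ := hk.exists_boundedContinuous_eLpNorm_sub_le (by norm_num)
    (ε := ENNReal.ofReal ε) (by simpa using hε)
  refine ⟨b.compContinuous ⟨fun p => (φ p.1, φ p.2), by fun_prop⟩, fun P hP => ?_⟩
  have hm : MeasurePreserving φ (P : Measure E) ζ := ⟨hφ.measurable, hS P hP⟩
  have hmm := measurePreserving_pair hm
  refine ⟨hk.comp_measurePreserving hmm, le_trans (le_of_eq ?_) hb⟩
  exact eLpNorm_comp_measurePreserving (hk.sub (memLp_bcf b _)).1 hmm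

/-- The squared norm is the integral of the bounded continuous function `b * b` against `P ⊗ P`, and
`P ↦ P ⊗ P` is weakly continuous. -/
theorem continuous_eLpNorm_bcf (b : BoundedContinuousFunction (E × E) ℝ) :
    Continuous fun P : ProbabilityMeasure E =>
      (eLpNorm b 2 ((P : Measure E).prod (P : Measure E))).toReal := by
  have e (P : ProbabilityMeasure E) : (eLpNorm b 2 ((P : Measure E).prod (P : Measure E))).toReal =
      (∫ p, (b * b) p ∂((P.prod P : ProbabilityMeasure (E × E)) : Measure (E × E))) ^ (2⁻¹ : ℝ) := by
    rw [(memLp_bcf b _).eLpNorm_eq_integral_rpow_norm (by norm_num) (by norm_num),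
      ENNReal.toReal_ofReal (by positivity)]
    simp [← sq]
  simp_rw [e]
  have hc : Continuous fun P : ProbabilityMeasure E => P.prod P :=
    ProbabilityMeasure.continuous_prod.comp (continuous_id.prodMk continuous_id)
  refine Continuous.rpow_const ?_ fun _ => Or.inr (by norm_num)
  exact (ProbabilityMeasure.continuous_integral_boundedContinuousFunction (b * b)).comp hc

/-- By the reverse triangle inequality in `L²`, the norm of `f` is a uniform limit on `S` of the
continuous norms of its approximants. -/
theorem continuousOn_eLpNorm (hf : UniformlyApproximable S f) :
    ContinuousOn (fun P : ProbabilityMeasure E =>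
      (eLpNorm f 2 ((P : Measure E).prod (P : Measure E))).toReal) S := by
  refine continuousOn_of_uniform_approx_of_continuousOn fun u hu => ?_
  obtain ⟨ε, hε, hu⟩ := Metric.mem_uniformity_dist.1 hu
  obtain ⟨b, hb⟩ := hf (ε / 2) (half_pos hε)
  refine ⟨_, (continuous_eLpNorm_bcf b).continuousOn, fun P hP => hu ?_⟩
  obtain ⟨h1, h2⟩ := hb P hP
  have hbm := memLp_bcf b ((P : Measure E).prod (P : Measure E))
  have h3 : ‖h1.toLp - hbm.toLp‖ ≤ ε / 2 := by
    rw [← MemLp.toLp_sub, Lp.norm_toLp]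
    exact ENNReal.toReal_le_of_le_ofReal (half_pos hε).le h2
  rw [Real.dist_eq, ← Lp.norm_toLp f h1, ← Lp.norm_toLp b hbm]
  have h4 := abs_norm_sub_norm_le h1.toLp hbm.toLp
  linarith

end UniformlyApproximable

end Continuity

/-! ### Weighted sums of squares and the variational property of the mean. -/

section WeightedSquares

variable {α : Type*} [MeasurableSpace α] {N : ℕ}

/-- Once all terms live on the same measure space, losses can be compared through a pointwise
inequality of integrands. -/
theorem sum_mul_eLpNorm_sq {μ : Measure α} {ρ : Fin N → ℝ} (hρ : ∀ i, 0 ≤ ρ i)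
    {F : Fin N → α → ℝ} (hF : ∀ i, AEStronglyMeasurable (F i) μ) :
    ∑ i, ENNReal.ofReal (ρ i) * eLpNorm (F i) 2 μ ^ 2 =
      ∫⁻ x, ENNReal.ofReal (∑ i, ρ i * F i x ^ 2) ∂μ := by
  have h1 (i : Fin N) : eLpNorm (F i) 2 μ ^ 2 = ∫⁻ x, ENNReal.ofReal (F i x ^ 2) ∂μ := by
    have := eLpNorm_nnreal_pow_eq_lintegral (f := F i) (μ := μ) (p := 2) (by norm_num)
    simp only [NNReal.coe_ofNat, ENNReal.coe_ofNat, ENNReal.rpow_ofNat] at this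
    rw [this]
    refine lintegral_congr fun x => ?_
    rw [Real.enorm_eq_ofReal_abs, ← ENNReal.ofReal_pow (abs_nonneg _), sq_abs]
  have h2 (x : α) : ENNReal.ofReal (∑ i, ρ i * F i x ^ 2) =
      ∑ i, ENNReal.ofReal (ρ i) * ENNReal.ofReal (F i x ^ 2) := by
    rw [ENNReal.ofReal_sum_of_nonneg fun i _ => mul_nonneg (hρ i) (sq_nonneg _)]
    exact Finset.sum_congr rfl fun i _ => ENNReal.ofReal_mul (hρ i)
  have h3 (i : Fin N) : AEMeasurable (fun x => ENNReal.ofReal (F i x ^ 2)) μ :=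
    ((hF i).aemeasurable.pow_const 2).ennreal_ofReal
  simp_rw [h1, h2]
  rw [lintegral_finsetSum' _ fun i _ => (h3 i).const_mul _]
  exact Finset.sum_congr rfl fun i _ => (lintegral_const_mul'' _ (h3 i)).symm

/-- The weighted mean minimizes the weighted sum of squared distances. -/
theorem sum_mul_sub_mean_sq_le {ρ : Fin N → ℝ} (hρ : ρ ∈ stdSimplex ℝ (Fin N)) (a : Fin N → ℝ)
    (c : ℝ) : ∑ i, ρ i * (a i - ∑ j, ρ j * a j) ^ 2 ≤ ∑ i, ρ i * (a i - c) ^ 2 := by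
  set m := ∑ j, ρ j * a j with hm
  -- Steiner's identity, valid because the weights sum to one.
  have h1 : ∑ i, ρ i * (a i - c) ^ 2 - ∑ i, ρ i * (a i - m) ^ 2 = (m - c) ^ 2 := by
    have h2 (i : Fin N) : ρ i * (a i - c) ^ 2 - ρ i * (a i - m) ^ 2 =
        2 * (m - c) * (ρ i * a i) + (c ^ 2 - m ^ 2) * ρ i := by ring
    rw [← Finset.sum_sub_distrib, Finset.sum_congr rfl fun i _ => h2 i, Finset.sum_add_distrib,
      ← Finset.mul_sum, ← Finset.mul_sum, hρ.2, ← hm]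
    ring
  nlinarith [sq_nonneg (m - c)]

end WeightedSquares

/-! ### Admissible couplings and minimization of the spread. -/

section Admissible

variable {N : ℕ} (Y : GMSpace.{u}) (X : Fin N → GMSpace.{u})

/-- The difference of the gauges of `Y` in two of the `Y`-coordinates. -/
def baseDefect (i j : Fin N) : (∀ i, Y × X i) × (∀ i, Y × X i) → ℝ :=
  pull (fun z => (z i).1) Y.gauge - pull (fun z => (z j).1) Y.gauge

/-- The deviation of the `i`-th gauge from the mean gauge. -/
def meanDefect (ρ : Fin N → ℝ) (i : Fin N) : (∀ i, Y × X i) × (∀ i, Y × X i) → ℝ :=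
  pull (fun z => (z i).2) (X i).gauge - pull (fun z i => (z i).2) (meanGauge X ρ)

/-- The couplings of the plans `π i` along which all the pullbacks of the gauge of `Y` agree. -/
def admissible (π : ∀ i, Measure (Y × X i)) : Set (ProbabilityMeasure (∀ i, Y × X i)) :=
  {P | P ∈ withMarginals π ∧ ∀ i j, eLpNorm (baseDefect Y X i j) 2
    ((P : Measure (∀ i, Y × X i)).prod (P : Measure (∀ i, Y × X i))) = 0}

/-- The weighted variance of the gauges along a coupling. -/
noncomputable def spread (ρ : Fin N → ℝ) (P : Measure (∀ i, Y × X i)) : ℝ≥0∞ :=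
  ∑ i, ENNReal.ofReal (ρ i) * eLpNorm (meanDefect Y X ρ i) 2 (P.prod P) ^ 2

variable {Y X} {π : ∀ i, Measure (Y × X i)}

theorem mp_coord_fst (hπ : ∀ i, IsPlan Y (X i) (π i)) {P : ProbabilityMeasure (∀ i, Y × X i)}
    (hP : P ∈ withMarginals π) (i : Fin N) :
    MeasurePreserving (fun z : ∀ i, Y × X i => (z i).1) (P : Measure (∀ i, Y × X i))
      Y.measure :=
  (hπ i).mp_fst.comp ⟨measurable_pi_apply i, hP i⟩

theorem mp_coord_snd (hπ : ∀ i, IsPlan Y (X i) (π i)) {P : ProbabilityMeasure (∀ i, Y × X i)}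
    (hP : P ∈ withMarginals π) (i : Fin N) :
    MeasurePreserving (fun z : ∀ i, Y × X i => (z i).2) (P : Measure (∀ i, Y × X i))
      (X i).measure :=
  (hπ i).mp_snd.comp ⟨measurable_pi_apply i, hP i⟩

theorem uniformlyApproximable_baseDefect (hπ : ∀ i, IsPlan Y (X i) (π i)) (i j : Fin N) :
    UniformlyApproximable (withMarginals π) (baseDefect Y X i j) :=
  (UniformlyApproximable.pull_of_map_eq (by fun_prop) (fun _ hP => (mp_coord_fst hπ hP i).map_eq)
    Y.isGauge.memLp).sub
  (UniformlyApproximable.pull_of_map_eq (by fun_prop) (fun _ hP => (mp_coord_fst hπ hP j).map_eq)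
    Y.isGauge.memLp)

/-- The mean gauge depends on all coordinates jointly, whose law varies with the coupling, but it is
a linear combination of kernels in one coordinate each. -/
theorem uniformlyApproximable_meanDefect (hπ : ∀ i, IsPlan Y (X i) (π i)) (ρ : Fin N → ℝ)
    (i : Fin N) : UniformlyApproximable (withMarginals π) (meanDefect Y X ρ i) := by
  have h (j : Fin N) : UniformlyApproximable (withMarginals π)
      (pull (fun z : ∀ i, Y × X i => (z j).2) (X j).gauge) :=
    UniformlyApproximable.pull_of_map_eq (by fun_prop)
      (fun _ hP => (mp_coord_snd hπ hP j).map_eq) (X j).isGauge.memLp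
  have e : meanDefect Y X ρ i = pull (fun z => (z i).2) (X i).gauge -
      ∑ j, ρ j • pull (fun z : ∀ i, Y × X i => (z j).2) (X j).gauge := by
    funext p
    simp [meanDefect, meanGauge, pull]
  rw [e]
  exact (h i).sub (UniformlyApproximable.sum _ fun j => (h j).const_smul (ρ j))

/-- Agreement of the gauges is the vanishing of norms that are continuous on the compact set
`withMarginals π`, hence a closed condition. -/
theorem isCompact_admissible (hπ : ∀ i, IsPlan Y (X i) (π i)) : IsCompact (admissible Y X π) := by
  have := fun i => (hπ i).prob
  have hc : IsClosed (admissible Y X π) := by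
    have e : admissible Y X π = withMarginals π ∩ ⋂ i, ⋂ j, withMarginals π ∩
        (fun P : ProbabilityMeasure (∀ i, Y × X i) => (eLpNorm (baseDefect Y X i j) 2
          ((P : Measure (∀ i, Y × X i)).prod (P : Measure (∀ i, Y × X i)))).toReal) ⁻¹' {0} := by
      ext P
      simp only [admissible, mem_ofPred_eq, mem_inter_iff, mem_iInter, mem_preimage,
        mem_singleton_iff]
      refine and_congr_right fun hP => forall_congr' fun i => forall_congr' fun j => ?_
      rw [ENNReal.toReal_eq_zero_iff]
      have := ((uniformlyApproximable_baseDefect hπ i j).memLp hP).2.ne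
      tauto
    rw [e]
    refine (isClosed_withMarginals π).inter (isClosed_iInter fun i => isClosed_iInter fun j => ?_)
    exact (uniformlyApproximable_baseDefect hπ i j).continuousOn_eLpNorm.preimage_isClosed_of_isClosed
      (isClosed_withMarginals π) isClosed_singleton
  exact (isCompact_withMarginals π).of_isClosed_subset hc fun P hP => hP.1

theorem exists_spread_le (hπ : ∀ i, IsPlan Y (X i) (π i)) (ρ : Fin N → ℝ)
    (hne : (admissible Y X π).Nonempty) :
    ∃ P ∈ admissible Y X π, ∀ Q ∈ admissible Y X π,
      spread Y X ρ (P : Measure (∀ i, Y × X i)) ≤ spread Y X ρ (Q : Measure (∀ i, Y × X i)) := by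
  have hcont : ContinuousOn (fun P : ProbabilityMeasure (∀ i, Y × X i) =>
      spread Y X ρ (P : Measure (∀ i, Y × X i))) (admissible Y X π) := by
    refine continuousOn_finsetSum _ fun i _ => ?_
    have h1 := (uniformlyApproximable_meanDefect hπ ρ i).continuousOn_eLpNorm.mono
      fun P (hP : P ∈ admissible Y X π) => hP.1
    have h2 : ContinuousOn (fun P : ProbabilityMeasure (∀ i, Y × X i) =>
        eLpNorm (meanDefect Y X ρ i) 2
          ((P : Measure (∀ i, Y × X i)).prod (P : Measure (∀ i, Y × X i))))
        (admissible Y X π) :=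
      (ENNReal.continuous_ofReal.comp_continuousOn h1).congr fun P hP =>
        (ENNReal.ofReal_toReal ((uniformlyApproximable_meanDefect hπ ρ i).memLp hP.1).2.ne).symm
    exact (ENNReal.continuous_const_mul ENNReal.ofReal_ne_top).comp_continuousOn
      ((ENNReal.continuous_pow 2).comp_continuousOn h2)
  obtain ⟨P, hP, hmin⟩ := (isCompact_admissible hπ).exists_isMinOn hne hcont
  exact ⟨P, hP, fun Q hQ => hmin hQ⟩

/-- Couplings of the plans `π i` with a common space, along which the gauge of `Y` is the pullback
of a common gauge, induce an admissible coupling with at most the same loss. -/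
theorem exists_admissible_spread_le (hπ : ∀ i, IsPlan Y (X i) (π i)) {ρ : Fin N → ℝ}
    (hρ : ρ ∈ stdSimplex ℝ (Fin N)) {W : Type*} [MeasurableSpace W] {μ : Measure W}
    [IsProbabilityMeasure μ] {h f : W × W → ℝ} (hf : AEStronglyMeasurable f (μ.prod μ))
    (τ : ∀ i, Measure ((Y × X i) × W)) (hp : ∀ i, IsProbabilityMeasure (τ i))
    (hfst : ∀ i, (τ i).map Prod.fst = π i) (hsnd : ∀ i, (τ i).map Prod.snd = μ)
    (hτ : ∀ i, ∀ᵐ p ∂(τ i).prod (τ i), Y.gauge (p.1.1.1, p.2.1.1) = h (p.1.2, p.2.2)) :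
    ∃ P ∈ admissible Y X π, spread Y X ρ (P : Measure (∀ i, Y × X i)) ≤
      ∑ i, ENNReal.ofReal (ρ i) *
        discrepancy (pull Prod.snd (X i).gauge - pull Prod.fst Y.gauge) f (τ i) ^ 2 := by
  -- The gluing is along `W`, hence the swaps; dropping `W` afterwards gives the required coupling.
  obtain ⟨ω, hω, hm⟩ := exists_common_gluing μ (fun i => (τ i).map Prod.swap)
    (fun i => Measure.isProbabilityMeasure_map (by fun_prop))
    (fun i => by rw [Measure.map_map (by fun_prop) (by fun_prop)]; exact hsnd i)
  have hq (i : Fin N) : MeasurePreserving (fun p : W × (∀ i, Y × X i) => (p.2 i, p.1)) ω (τ i) := by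
    refine ⟨by fun_prop, ?_⟩
    have := congrArg (Measure.map Prod.swap) (hm i)
    rw [Measure.map_map (by fun_prop) (by fun_prop),
      Measure.map_map (by fun_prop) (by fun_prop), Prod.swap_swap_eq, Measure.map_id] at this
    exact this
  have hPω : MeasurePreserving Prod.snd ω (ω.map Prod.snd) := ⟨measurable_snd, rfl⟩
  let P : ProbabilityMeasure (∀ i, Y × X i) :=
    ⟨ω.map Prod.snd, Measure.isProbabilityMeasure_map (by fun_prop)⟩
  have hPc : (P : Measure (∀ i, Y × X i)) = ω.map Prod.snd := rfl
  have hP : P ∈ withMarginals π := by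
    intro i
    rw [← hfst i, ← (hq i).map_eq, hPc, Measure.map_map (by fun_prop) (by fun_prop),
      Measure.map_map (by fun_prop) (by fun_prop)]
    rfl
  have hPP := measurePreserving_pair hPω
  have hbase (i : Fin N) : ∀ᵐ p ∂ω.prod ω,
      Y.gauge ((p.1.2 i).1, (p.2.2 i).1) = h (p.1.1, p.2.1) :=
    (measurePreserving_pair (hq i)).quasiMeasurePreserving.ae (hτ i)
  refine ⟨P, ⟨hP, fun i j => ?_⟩, ?_⟩
  · have hd := (uniformlyApproximable_baseDefect hπ i j).memLp hP
    rw [hPc] at hd ⊢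
    rw [← eLpNorm_comp_measurePreserving hd.1 hPP, eLpNorm_eq_zero_iff
      (hd.1.comp_measurePreserving hPP) (by norm_num)]
    filter_upwards [hbase i, hbase j] with p h1 h2
    simp [baseDefect, pull, h1, h2]
  · have hpY (i : Fin N) : MeasurePreserving (Prod.fst ∘ Prod.fst) (τ i) Y.measure :=
      (hπ i).mp_fst.comp ⟨measurable_fst, hfst i⟩
    have hpX (i : Fin N) : MeasurePreserving (Prod.snd ∘ Prod.fst) (τ i) (X i).measure :=
      (hπ i).mp_snd.comp ⟨measurable_fst, hfst i⟩
    have hpW (i : Fin N) : MeasurePreserving Prod.snd (τ i) μ := ⟨measurable_snd, hsnd i⟩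
    have ha (i : Fin N) : AEStronglyMeasurable (fun p : ((Y × X i) × W) × ((Y × X i) × W) =>
        (pull Prod.snd (X i).gauge - pull Prod.fst Y.gauge : (Y × X i) × (Y × X i) → ℝ)
          (p.1.1, p.2.1) - f (p.1.2, p.2.2))
        ((τ i).prod (τ i)) :=
      (((X i).isGauge.pull (hpX i)).memLp.1.sub (Y.isGauge.pull (hpY i)).memLp.1).sub
        (hf.comp_measurePreserving (measurePreserving_pair (hpW i)))
    have e1 (i : Fin N) := eLpNorm_comp_measurePreserving (p := 2) (ha i)
      (measurePreserving_pair (hq i))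
    have hd (i : Fin N) := ((uniformlyApproximable_meanDefect hπ ρ i).memLp hP).1
    simp only [spread, discrepancy]
    rw [hPc] at hd ⊢
    simp_rw [← e1]
    simp_rw [fun i => (eLpNorm_comp_measurePreserving (p := 2) (hd i) hPP).symm]
    rw [sum_mul_eLpNorm_sq hρ.1 fun i => (hd i).comp_measurePreserving hPP,
      sum_mul_eLpNorm_sq hρ.1 fun i =>
        (ha i).comp_measurePreserving (measurePreserving_pair (hq i))]
    refine lintegral_mono_ae ?_
    filter_upwards [ae_all_iff.2 hbase] with p hb
    refine ENNReal.ofReal_le_ofReal ?_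
    -- Every copy of the gauge of `Y` equals `h` here, so the `i`-th term is `gᵢ - (h + f)`, and `h
    -- + f` does not depend on `i`.
    refine (sum_mul_sub_mean_sq_le hρ (fun i => (X i).gauge ((p.1.2 i).2, (p.2.2 i).2))
      (h (p.1.1, p.2.1) + f (p.1.1, p.2.1))).trans (le_of_eq ?_)
    refine Finset.sum_congr rfl fun i _ => ?_
    simp only [Function.comp_apply, Pi.sub_apply, pull, hb i, sub_sub]

end Admissible

/-! ### Comparing the spread with the barycenter loss. -/

section Barycenter

variable {N : ℕ} {Y : GMSpace.{u}} {X : Fin N → GMSpace.{u}} {π : ∀ i, Measure (Y × X i)}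

/-- Optimal plans exist. -/
theorem exists_isOptimal (X Y : GMSpace.{u}) : ∃ τ, IsOptimal X Y τ := by
  let S : Set (ProbabilityMeasure (X × Y)) :=
    {P | P.map (f := Prod.fst) measurable_fst.aemeasurable = ⟨X.measure, inferInstance⟩} ∩
      {P | P.map (f := Prod.snd) measurable_snd.aemeasurable = ⟨Y.measure, inferInstance⟩}
  have hS {P : ProbabilityMeasure (X × Y)} (hP : P ∈ S) :
      IsPlan X Y (P : Measure (X × Y)) :=
    ⟨inferInstance, congrArg Subtype.val hP.1, congrArg Subtype.val hP.2⟩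
  have hS' {τ : Measure (X × Y)} (hτ : IsPlan X Y τ) : ⟨τ, hτ.prob⟩ ∈ S :=
    ⟨Subtype.ext hτ.fst, Subtype.ext hτ.snd⟩
  let := TopologicalSpace.upgradeIsCompletelyMetrizable X
  let := TopologicalSpace.upgradeIsCompletelyMetrizable Y
  have hclosed : IsClosed S :=
    (isClosed_eq (ProbabilityMeasure.continuous_map continuous_fst) continuous_const).inter
      (isClosed_eq (ProbabilityMeasure.continuous_map continuous_snd) continuous_const)
  have htight : IsTightMeasureSet
      {((P : ProbabilityMeasure (X × Y)) : Measure (X × Y)) | P ∈ S} := by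
    refine IsTightMeasureSet.prodMk
      ((isTightMeasureSet_singleton (μ := X.measure)).subset ?_)
      ((isTightMeasureSet_singleton (μ := Y.measure)).subset ?_)
    · rintro _ ⟨_, ⟨P, hP, rfl⟩, rfl⟩
      exact (hS hP).fst
    · rintro _ ⟨_, ⟨P, hP, rfl⟩, rfl⟩
      exact (hS hP).snd
  have hcompact : IsCompact S := by
    have := isCompact_closure_of_isTightMeasureSet htight
    rwa [hclosed.closure_eq] at this
  -- The Gromov–Wasserstein functional is the norm of this kernel, hence continuous on the compact
  -- set `S`.
  have happrox : UniformlyApproximable S (pull Prod.fst X.gauge - pull Prod.snd Y.gauge) :=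
    (UniformlyApproximable.pull_of_map_eq continuous_fst (fun _ hP => (hS hP).fst)
      X.isGauge.memLp).sub
    (UniformlyApproximable.pull_of_map_eq continuous_snd (fun _ hP => (hS hP).snd)
      Y.isGauge.memLp)
  have hprod : IsPlan X Y (X.measure.prod Y.measure) :=
    ⟨inferInstance, Measure.map_fst_prod.trans (by simp), Measure.map_snd_prod.trans (by simp)⟩
  obtain ⟨P, hP, hmin⟩ := hcompact.exists_isMinOn ⟨_, hS' hprod⟩ happrox.continuousOn_eLpNorm
  refine ⟨P, hS hP, le_antisymm (le_iInf fun τ => ?_) (gwDist_le (hS hP))⟩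
  exact (ENNReal.toReal_le_toReal (happrox.memLp hP).2.ne (happrox.memLp (hS' τ.2)).2.ne).1
    (hmin (hS' τ.2))

/-- The representative of `lift Y X π`. -/
def liftRep (Y X : GMSpace.{u}) (π : Measure (Y × X)) (hπ : IsPlan Y X π) :
    TangentRep Y.toClass where
  base := Y.over π hπ.prob hπ.fst
  base_mem := Y.over_toClass π hπ.prob hπ.fst
  toFun := pull Prod.snd X.gauge - pull Prod.fst Y.gauge
  isGauge :=
    have := hπ.prob
    (X.isGauge.pull hπ.mp_snd).sub (Y.isGauge.pull hπ.mp_fst)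

/-- The plans are glued along `Y` itself: each `(Y × X i, h, π i)` is coupled to `Y` at zero cost by
its projection. The kernel `f` is arbitrary, since the bound on the spread is discarded. -/
theorem admissible_nonempty (hπ : ∀ i, IsPlan Y (X i) (π i)) {ρ : Fin N → ℝ}
    (hρ : ρ ∈ stdSimplex ℝ (Fin N)) : (admissible Y X π).Nonempty := by
  have := fun i => (hπ i).prob
  have hmp (i : Fin N) : IsProbabilityMeasure ((π i).map fun p => (p, p.1)) :=
    Measure.isProbabilityMeasure_map (by fun_prop)
  have hfst (i : Fin N) : ((π i).map fun p => (p, p.1)).map Prod.fst = π i := by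
    rw [Measure.map_map (by fun_prop) (by fun_prop)]
    exact Measure.map_id
  have hsnd (i : Fin N) : ((π i).map fun p => (p, p.1)).map Prod.snd = Y.measure := by
    rw [Measure.map_map (by fun_prop) (by fun_prop)]
    exact (hπ i).fst
  obtain ⟨P, hP, -⟩ := exists_admissible_spread_le (W := Y) (h := Y.gauge) (f := Y.gauge) hπ hρ
    Y.isGauge.memLp.1 _ hmp hfst hsnd fun i => by
      let Z := Y.over (π i) (hπ i).prob (hπ i).fst
      have hplan : IsPlan Z Y ((π i).map fun p => (p, p.1)) := ⟨hmp i, hfst i, hsnd i⟩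
      refine (discrepancy_eq_zero_iff hplan Z.isGauge Y.isGauge).1 ?_
      refine (discrepancy_map (X := Z) (Y := Y) (ω := π i) (a := id) (b := Prod.fst)
        measurable_id measurable_fst hplan Z.isGauge Y.isGauge).trans ?_
      have h0 : (fun p : (Y × X i) × (Y × X i) =>
          Z.gauge (id p.1, id p.2) - Y.gauge (p.1.1, p.2.1)) = 0 :=
        funext fun p => sub_self (Y.gauge (p.1.1, p.2.1))
      exact (congrArg (fun F => eLpNorm F 2 ((π i).prod (π i))) h0).trans eLpNorm_zero
  exact ⟨P, hP⟩

/-- A minimal spread over the admissible couplings bounds the barycenter loss from below. -/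
theorem le_barycenterLoss (hπ : ∀ i, IsPlan Y (X i) (π i)) {ρ : Fin N → ℝ}
    (hρ : ρ ∈ stdSimplex ℝ (Fin N)) {s : ℝ≥0∞}
    (hs : ∀ Q ∈ admissible Y X π, s ≤ spread Y X ρ (Q : Measure (∀ i, Y × X i)))
    (𝔣 : TangentSpace Y.toClass) :
    s ≤ barycenterLoss ρ (fun i => lift Y (X i) (π i) (hπ i)) 𝔣 := by
  obtain ⟨f, rfl⟩ := Quotient.exists_rep 𝔣
  have hle (τ : ∀ i, {τ : Measure ((liftRep Y (X i) (π i) (hπ i)).base × f.base) //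
      IsOptimal (liftRep Y (X i) (π i) (hπ i)).base f.base τ}) :
      s ≤ ∑ i, ENNReal.ofReal (ρ i) *
        discrepancy (liftRep Y (X i) (π i) (hπ i)).toFun f.toFun (τ i).1 ^ 2 := by
    have h0 (i : Fin N) := (TangentRep.isOptimal_iff _ _).1 (τ i).2
    obtain ⟨P, hP, h⟩ := exists_admissible_spread_le (W := f.base) (μ := f.base.measure)
      (h := f.base.gauge) hπ hρ f.isGauge.memLp.1 (fun i => (τ i).1)
      (fun i => (h0 i).1.prob) (fun i => (h0 i).1.fst) (fun i => (h0 i).1.snd)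
      fun i => (discrepancy_eq_zero_iff (h0 i).1 (GMSpace.isGauge _) f.base.isGauge).1 (h0 i).2
    exact (hs P hP).trans h
  -- The infima defining the tangent distances need not be shown to be attained: `hle` is applied
  -- along minimizing sequences, one for each `i`, and passes to the limit.
  have hne (i : Fin N) : Nonempty {τ : Measure ((liftRep Y (X i) (π i) (hπ i)).base × f.base) //
      IsOptimal (liftRep Y (X i) (π i) (hπ i)).base f.base τ} :=
    nonempty_subtype.2 (exists_isOptimal _ _)
  have hseq (i : Fin N) := exists_seq_tendsto_sInf (S := range
      fun τ : {τ : Measure ((liftRep Y (X i) (π i) (hπ i)).base × f.base) //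
        IsOptimal (liftRep Y (X i) (π i) (hπ i)).base f.base τ} =>
      discrepancy (liftRep Y (X i) (π i) (hπ i)).toFun f.toFun τ.1)
    (range_nonempty _) (OrderBot.bddBelow _)
  choose u _ hu hmem using hseq
  choose τ hτ using hmem
  have hlim : Tendsto (fun n => ∑ i, ENNReal.ofReal (ρ i) * u i n ^ 2) atTop
      (𝓝 (∑ i, ENNReal.ofReal (ρ i) * (liftRep Y (X i) (π i) (hπ i)).dist f ^ 2)) :=
    tendsto_finsetSum _ fun i _ => ENNReal.Tendsto.const_mul
      (((ENNReal.continuous_pow 2).tendsto _).comp (hu i)) (Or.inr ENNReal.ofReal_ne_top)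
  refine ge_of_tendsto' hlim fun n => ?_
  simp_rw [← hτ]
  exact hle fun i => τ i n

/-- The map forgetting all but one of the `Y`-coordinates. -/
def forgetBase (Y : GMSpace.{u}) (X : Fin N → GMSpace.{u}) (i₀ : Fin N) (z : ∀ i, Y × X i) :
    Y × (∀ i, X i) :=
  ((z i₀).1, fun i => (z i).2)

theorem measurable_forgetBase (i₀ : Fin N) : Measurable (forgetBase Y X i₀) := by
  unfold forgetBase; fun_prop

theorem ae_gauge_eq_of_admissible (hπ : ∀ i, IsPlan Y (X i) (π i))
    {P : ProbabilityMeasure (∀ i, Y × X i)} (hP : P ∈ admissible Y X π) (i j : Fin N) :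
    ∀ᵐ p ∂(P : Measure (∀ i, Y × X i)).prod (P : Measure (∀ i, Y × X i)),
      Y.gauge ((p.1 i).1, (p.2 i).1) = Y.gauge ((p.1 j).1, (p.2 j).1) := by
  have h := (eLpNorm_eq_zero_iff ((uniformlyApproximable_baseDefect hπ i j).memLp hP.1).1
    (by norm_num)).1 (hP.2 i j)
  filter_upwards [h] with p hp
  exact sub_eq_zero.1 hp

/-- Exchanging the `Y`-coordinate along an admissible coupling yields equivalent plans. -/
theorem planEquiv_of_admissible (hπ : ∀ i, IsOptimal Y (X i) (π i))
    {P : ProbabilityMeasure (∀ i, Y × X i)} (hP : P ∈ admissible Y X π) (i₀ i : Fin N) :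
    PlanEquiv Y (X i)
      ((P : Measure (∀ i, Y × X i)).map fun z => ((z i₀).1, (z i).2)) (π i) := by
  have hpl := fun i => (hπ i).isPlan
  have hae := ae_gauge_eq_of_admissible hpl hP
  have hplan : IsPlan Y (X i)
      ((P : Measure (∀ i, Y × X i)).map fun z => ((z i₀).1, (z i).2)) := by
    refine ⟨Measure.isProbabilityMeasure_map (by fun_prop), ?_, ?_⟩
    · rw [Measure.map_map (by fun_prop) (by fun_prop)]
      exact (mp_coord_fst hpl hP.1 i₀).map_eq
    · rw [Measure.map_map (by fun_prop) (by fun_prop)]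
      exact (mp_coord_snd hpl hP.1 i).map_eq
  have hself : IsPlan Y Y ((P : Measure (∀ i, Y × X i)).map fun z => ((z i).1, (z i₀).1)) := by
    refine ⟨Measure.isProbabilityMeasure_map (by fun_prop), ?_, ?_⟩
    · rw [Measure.map_map (by fun_prop) (by fun_prop)]
      exact (mp_coord_fst hpl hP.1 i).map_eq
    · rw [Measure.map_map (by fun_prop) (by fun_prop)]
      exact (mp_coord_fst hpl hP.1 i₀).map_eq
  have hmarg : (P : Measure (∀ i, Y × X i)).map (fun z => ((z i).1, (z i).2)) = π i := hP.1 i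
  -- The self-coupling of `Y` is the joint law of its `i`-th and `i₀`-th copies; adding the `X
  -- i`-coordinate gives the gluing that witnesses the melting.
  refine ⟨⟨hplan, ?_⟩, hπ i, _, ⟨hself, ?_⟩,
    (P : Measure (∀ i, Y × X i)).map fun z => ((z i).1, (z i₀).1, (z i).2), ⟨?_, ?_, ?_⟩, ?_⟩
  -- Replacing the `i`-th copy of `Y` by the `i₀`-th changes the integrand only on a null set, so
  -- the new plan inherits the optimal value of `π i`.
  · rw [← (hπ i).eq_gwDist, gwFunctional, gwFunctional]
    have h1 := discrepancy_map (ω := (P : Measure (∀ i, Y × X i))) (a := fun z => (z i).1)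
      (b := fun z => (z i).2) (by fun_prop) (by fun_prop) (by rw [hmarg]; exact hpl i)
      Y.isGauge (X i).isGauge
    rw [hmarg] at h1
    rw [h1, discrepancy_map (by fun_prop) (by fun_prop) hplan Y.isGauge (X i).isGauge]
    refine eLpNorm_congr_ae ?_
    filter_upwards [hae i₀ i] with p hp
    rw [hp]
  · rw [gwDist_self, gwFunctional,
      discrepancy_map (by fun_prop) (by fun_prop) hself Y.isGauge Y.isGauge]
    exact hP.2 i i₀
  · exact Measure.isProbabilityMeasure_map (by fun_prop)
  · rw [Measure.map_map (by fun_prop) (by fun_prop)]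
    rfl
  · rw [Measure.map_map (by fun_prop) (by fun_prop)]
    exact hmarg
  · rw [Measure.map_map (by fun_prop) (by fun_prop)]
    rfl

theorem isGluing_of_admissible (hπ : ∀ i, IsPlan Y (X i) (π i))
    {P : ProbabilityMeasure (∀ i, Y × X i)} (hP : P ∈ admissible Y X π) (i₀ : Fin N) :
    IsGluing Y X (fun i => (P : Measure (∀ i, Y × X i)).map fun z => ((z i₀).1, (z i).2))
      ((P : Measure (∀ i, Y × X i)).map (forgetBase Y X i₀)) := by
  have hm := measurable_forgetBase (Y := Y) (X := X) i₀
  refine ⟨Measure.isProbabilityMeasure_map hm.aemeasurable, ?_, fun i => ?_⟩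
  · rw [Measure.map_map (by fun_prop) hm]
    exact (mp_coord_fst hπ hP.1 i₀).map_eq
  · rw [Measure.map_map (by fun_prop) hm]
    rfl

/-- The spread of an admissible coupling bounds the loss of the induced mean tangent. -/
theorem barycenterLoss_meanTangent_le (hπ : ∀ i, IsPlan Y (X i) (π i)) (ρ : Fin N → ℝ)
    {P : ProbabilityMeasure (∀ i, Y × X i)} (hP : P ∈ admissible Y X π) (i₀ : Fin N)
    {π' : ∀ i, Measure (Y × X i)} (hπ' : ∀ i, IsPlan Y (X i) (π' i))
    (hγ : IsGluing Y X π' ((P : Measure (∀ i, Y × X i)).map (forgetBase Y X i₀))) :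
    barycenterLoss ρ (fun i => lift Y (X i) (π i) (hπ i)) (meanTangent Y X ρ π' hπ' _ hγ) ≤
      spread Y X ρ (P : Measure (∀ i, Y × X i)) := by
  have hm := measurable_forgetBase (Y := Y) (X := X) i₀
  refine Finset.sum_le_sum fun i _ => ?_
  gcongr
  let Z := Y.over (π i) (hπ i).prob (hπ i).fst
  let V := Y.over ((P : Measure (∀ i, Y × X i)).map (forgetBase Y X i₀)) hγ.prob hγ.fst
  let a : (∀ i, Y × X i) → Z := fun z => z i
  let b : (∀ i, Y × X i) → V := forgetBase Y X i₀
  have ha : Measurable a := measurable_pi_apply i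
  have hb : Measurable b := hm
  -- The test plan for the tangent distance reads both spaces off the same point `z`. Its cost is
  -- the norm of `baseDefect Y X i i₀`, which is zero.
  have hplan : IsPlan Z V ((P : Measure (∀ i, Y × X i)).map fun z => (a z, b z)) := by
    refine ⟨Measure.isProbabilityMeasure_map (ha.prodMk hb).aemeasurable, ?_, ?_⟩
    · rw [Measure.map_map measurable_fst (ha.prodMk hb)]
      exact hP.1 i
    · rw [Measure.map_map measurable_snd (ha.prodMk hb)]
      rfl
  let r : TangentRep Y.toClass := liftRep Y (X i) (π i) (hπ i)
  let s : TangentRep Y.toClass :=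
    { base := V
      base_mem := Y.over_toClass _ hγ.prob hγ.fst
      toFun := pull Prod.snd (meanGauge X ρ) - pull Prod.fst Y.gauge
      isGauge :=
        have := hγ.prob
        (IsGauge.weightedSum ρ fun i => (X i).isGauge.pull (hγ.mp_coord hπ' i)).sub
          (Y.isGauge.pull ⟨measurable_fst, hγ.fst⟩) }
  have hopt : IsOptimal r.base s.base ((P : Measure (∀ i, Y × X i)).map fun z => (a z, b z)) := by
    refine (TangentRep.isOptimal_iff r s).2 ⟨hplan, ?_⟩
    exact (discrepancy_map (X := Z) (Y := V) ha hb hplan Z.isGauge V.isGauge).trans (hP.2 i i₀)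
  refine (TangentRep.dist_le (f := r) (f' := s) hopt).trans (le_of_eq ?_)
  refine (discrepancy_map (X := Z) (Y := V) ha hb hplan r.isGauge s.isGauge).trans ?_
  refine eLpNorm_congr_ae ?_
  filter_upwards [ae_gauge_eq_of_admissible hπ hP i i₀] with p hp
  -- The two subtracted gauges of `Y` sit in different coordinates, `i` and `i₀`; admissibility
  -- makes them cancel, which leaves `meanDefect`.
  change ((X i).gauge ((p.1 i).2, (p.2 i).2) - Y.gauge ((p.1 i).1, (p.2 i).1)) -
    (meanGauge X ρ (fun i => (p.1 i).2, fun i => (p.2 i).2) -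
      Y.gauge ((p.1 i₀).1, (p.2 i₀).1)) =
    (X i).gauge ((p.1 i).2, (p.2 i).2) - meanGauge X ρ (fun i => (p.1 i).2, fun i => (p.2 i).2)
  rw [hp]
  ring

end Barycenter

end GromovWasserstein

open GromovWasserstein
theorem theorem5p3 {N : ℕ} (ρ : Fin N → ℝ) (hρ : ρ ∈ stdSimplex ℝ (Fin N))
    (Y : GMSpace.{u}) (X : Fin N → GMSpace.{u})
    (π : ∀ i, Measure (Y × X i)) (hπ : ∀ i, IsOptimal Y (X i) (π i)) :
    (∃ 𝔣 : TangentSpace Y.toClass,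
      IsTangentialBarycenter ρ (fun i => lift Y (X i) (π i) (hπ i).isPlan) 𝔣) ∧
    ∃ (π' : ∀ i, Measure (Y × X i)) (hπ' : ∀ i, PlanEquiv Y (X i) (π' i) (π i))
      (γ : Measure (Y × (∀ i, X i))) (hγ : IsGluing Y X π' γ),
      IsTangentialBarycenter ρ (fun i => lift Y (X i) (π i) (hπ i).isPlan)
        (meanTangent Y X ρ π' (fun i => (hπ' i).left.isPlan) γ hγ) := by
  have hpl := fun i => (hπ i).isPlan
  -- An empty family of weights cannot sum to one. Any index may serve as the `Y`-coordinate that is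
  -- kept.
  obtain ⟨i₀⟩ : Nonempty (Fin N) := by
    by_contra h
    rw [not_nonempty_iff] at h
    simpa using hρ.2
  obtain ⟨P, hP, hmin⟩ := exists_spread_le hpl ρ (admissible_nonempty hpl hρ)
  have hequiv := planEquiv_of_admissible hπ hP i₀
  have hγ := isGluing_of_admissible hpl hP i₀
  have hsol : IsTangentialBarycenter ρ (fun i => lift Y (X i) (π i) (hpl i))
      (meanTangent Y X ρ _ (fun i => (hequiv i).left.isPlan) _ hγ) :=
    -- The loss of the mean tangent is at most the minimal spread, which bounds the loss of every
    -- tangent from below.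
    le_antisymm ((barycenterLoss_meanTangent_le hpl ρ hP i₀ _ hγ).trans
      (le_iInf fun 𝔣 => le_barycenterLoss hpl hρ hmin 𝔣)) (iInf_le _ _)
  exact ⟨⟨_, hsol⟩, _, hequiv, _, hγ, hsol⟩
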